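/- Let $\Gamma$ be a compact Lie group acting linearly on $\mathbb R^n$, let $f:\mathbb R^n\to\mathbb R^n$ be a $C^1$ vector field that is $\Gamma$-equivariant, $f(\gamma x)=\gamma f(x)$ for all $\gamma\in\Gamma$, $x\in\mathbb R^n$, and write $\Phi_t$ for the (possibly only local) flow of $\dot x=f(x)$. For an equilibrium $\xi$ let $W^u(\xi)$ and $W^s(\xi)$ be the sets of points whose trajectory exists for all $t\le 0$, respectively all $t\ge 0$, and converges to $\xi$ as $t\to-\infty$, respectively $t\to+\infty$. A one-dimensional connection from $\xi$ to $\eta$ is a nonconstant trajectory contained in $W^u(\xi)\cap W^s(\eta)$. A heteroclinic cycle consists of equilibria $\xi_1,\dots,\xi_{m+1}$ ($m\ge1$) with $\xi_{m+1}=\gamma\xi_1$ for some $\gamma\in\Gamma$, together with a connection from $\xi_j$ to $\xi_{j+1}$ for each $j=1,\dots,m$. A heteroclinic network is a connected set that is the union of heteroclinic cycles, at least two of which are different after identification of points in the same $\Gamma$-orbit. For a set $X$ and $\delta>0$ let $\mathcal B_\delta(X)$ be the set of points $x$ such that $\Phi_t(x)$ exists for all $t\ge0$, $d(\Phi_t(x),X)<\delta$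 for all $t>0$, and $d(\Phi_t(x),X)\to0$ as $t\to+\infty$; $X$ is asymptotically stable if for every $\delta>0$ there is $\varepsilon>0$ such that the $\varepsilon$-neighbourhood of $X$ is contained in $\mathcal B_\delta(X)$. Let $X\subset\mathbb R^n$ be a compact heteroclinic network comprised of equilibria $\xi_j$ and a finite number of one-dimensional connections (symmetric copies being counted separately). $X$ may be robust, i.e. persistent under $\Gamma$-equivariant perturbations of $f$, but this is not required. Suppose that some equilibrium $\xi_j\in X$ satisfies $\dim W^u(\xi_j)\ge2$, where $\dim$ is the Hausdorff dimension (which is the usual dimension when $W^u(\xi_j)$ is an injectively immersed $C^1$ manifold, as it is for hyperbolic $\xi_j$). Then $X$ is not asymptotically stable. -/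

import Mathlib

open Set Filter Topology

noncomputable section

namespace Heteroclinic

/-- Euclidean space `ℝⁿ`. -/
abbrev Space (n : ℕ) : Type := EuclideanSpace ℝ (Fin n)

variable {n : ℕ}

/-- `x` is an equilibrium of the autonomous equation `x' = f x`. -/
def IsEquilibrium (f : Space n → Space n) (x : Space n) : Prop := f x = 0

/-- The unstable manifold `W^u(ξ)`, as a subset of phase space: the points whose backward trajectory
is defined for all negative times and converges to `ξ`. -/
def unstableManifold (f : Space n → Space n) (ξ : Space n) : Set (Space n) :=
  {x | ∃ φ : ℝ → Space n, IsIntegralCurveOn φ (fun _ => f) (Iic 0) ∧ φ 0 = x ∧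
    Tendsto φ atBot (𝓝 ξ)}

/-- The stable manifold `W^s(ξ)`, as a subset of phase space: the points whose forward trajectory
is defined for all positive times and converges to `ξ`. -/
def stableManifold (f : Space n → Space n) (ξ : Space n) : Set (Space n) :=
  {x | ∃ φ : ℝ → Space n, IsIntegralCurveOn φ (fun _ => f) (Ici 0) ∧ φ 0 = x ∧
    Tendsto φ atTop (𝓝 ξ)}

/-- `κ` is a (one-dimensional) connection `[ξ → η]`: a single nonconstant trajectory contained in
`W^u(ξ) ∩ W^s(η)`. -/
def IsConnection (f : Space n → Space n) (ξ η : Space n) (κ : Set (Space n)) : Prop :=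
  (∃ φ : ℝ → Space n, IsIntegralCurve φ (fun _ => f) ∧ ¬ IsEquilibrium f (φ 0) ∧ κ = range φ) ∧
    κ ⊆ unstableManifold f ξ ∩ stableManifold f η

/-- A heteroclinic cycle of `f` with respect to the symmetry group `Γ`: equilibria
`ξ 0, …, ξ m` with `m ≥ 1` and connections `κ j = [ξ j → ξ (j + 1)]`, closing up modulo `Γ`,
that is, with `ξ m = γ • ξ 0` for some `γ ∈ Γ`. -/
structure Cycle (Γ : Type*) [Group Γ] [DistribMulAction Γ (Space n)]
    (f : Space n → Space n) where
  m : ℕ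
  m_pos : 0 < m
  ξ : Fin (m + 1) → Space n
  κ : Fin m → Set (Space n)
  isEquilibrium : ∀ i, IsEquilibrium f (ξ i)
  isConnection : ∀ j : Fin m, IsConnection f (ξ j.castSucc) (ξ j.succ) (κ j)
  closes : ∃ γ : Γ, ξ (Fin.last m) = γ • ξ 0

/-- The set of points of a cycle. -/
def Cycle.carrier {Γ : Type*} [Group Γ] [DistribMulAction Γ (Space n)]
    {f : Space n → Space n} (C : Cycle Γ f) : Set (Space n) :=
  range C.ξ ∪ ⋃ j, C.κ j

/-- The union of all images of a set under the symmetry group. -/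
def saturation (Γ : Type*) [Group Γ] [DistribMulAction Γ (Space n)] (S : Set (Space n)) :
    Set (Space n) :=
  {x | ∃ γ : Γ, ∃ y ∈ S, x = γ • y}

/-- A heteroclinic network: a connected set that is the union of a family of heteroclinic cycles,
at least two of which differ after identification of points in the same `Γ`-orbit. -/
structure Network (Γ : Type*) [Group Γ] [DistribMulAction Γ (Space n)]
    (f : Space n → Space n) where
  cycles : Set (Cycle Γ f)
  two_cycles : ∃ C ∈ cycles, ∃ C' ∈ cycles, saturation Γ C.carrier ≠ saturation Γ C'.carrier
  isConnected : IsConnected (⋃ C ∈ cycles, C.carrier)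

namespace Network

variable {Γ : Type*} [Group Γ] [DistribMulAction Γ (Space n)] {f : Space n → Space n}

/-- The set of points of a network. -/
def carrier (N : Network Γ f) : Set (Space n) := ⋃ C ∈ N.cycles, C.carrier

/-- The equilibria of a network. -/
def equilibria (N : Network Γ f) : Set (Space n) := {x | ∃ C ∈ N.cycles, ∃ i, x = C.ξ i}

/-- The connections of a network; symmetric copies that are different trajectories are different
elements. -/
def connections (N : Network Γ f) : Set (Set (Space n)) :=
  {κ | ∃ C ∈ N.cycles, ∃ j, κ = C.κ j}

end Network

/-- The dimension of `W^u(ξ)`, taken as the Hausdorff dimension of the set. It is defined without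
any hyperbolicity assumption and equals `k` when `W^u(ξ)` is an injectively immersed `C¹`
submanifold of dimension `k`. -/
def unstableDim (f : Space n → Space n) (ξ : Space n) : ENNReal := dimH (unstableManifold f ξ)

/-- The `δ`-basin of attraction of `X`: the points whose forward trajectory is defined for all
positive times, remains at distance less than `δ` from `X`, and converges to `X`. -/
def basin (f : Space n → Space n) (δ : ℝ) (X : Set (Space n)) : Set (Space n) :=
  {x | ∃ φ : ℝ → Space n, IsIntegralCurveOn φ (fun _ => f) (Ici 0) ∧ φ 0 = x ∧
    (∀ t > 0, Metric.infDist (φ t) X < δ) ∧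
    Tendsto (fun t => Metric.infDist (φ t) X) atTop (𝓝 0)}

/-- Asymptotic stability: every `δ`-basin contains an `ε`-neighbourhood of `X`. -/
def AsymptoticallyStable (f : Space n → Space n) (X : Set (Space n)) : Prop :=
  ∀ δ > 0, ∃ ε > 0, Metric.thickening ε X ⊆ basin f δ X

end Heteroclinic

end

/-!
Suppose that `X` is stable. A point `x` of `W^u(ξ)`, for `ξ ∈ X`, is reached in positive time from
points arbitrarily close to `ξ`, so by stability and uniqueness of solutions `x` lies within every
`δ > 0` of `X`; that is, `W^u(ξ) ⊆ X` when `X` is closed. But a network with countably many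
connections is a countable union of `C¹` curves and equilibria, hence of Hausdorff dimension at most
one. The equilibria are countable because each of them is an end of a connection, and a connection
determines its two ends.
-/

namespace Heteroclinic

theorem exists_lipschitzOnWith_image_union {T α β : Type*} [TopologicalSpace T]
    [PseudoMetricSpace α] [PseudoMetricSpace β] {g : α → β} {φ ψ : T → α} {s : Set T}
    (hg : LocallyLipschitz g) (hs : IsCompact s) (hφ : ContinuousOn φ s)
    (hψ : ContinuousOn ψ s) : ∃ K, LipschitzOnWith K g (φ '' s ∪ ψ '' s) :=
  LocallyLipschitzOn.exists_lipschitzOnWith_of_compact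
    ((hs.image_of_continuousOn hφ).union (hs.image_of_continuousOn hψ)) hg.locallyLipschitzOn

section IntegralCurve

variable {E : Type*} [NormedAddCommGroup E] [NormedSpace ℝ E] {φ ψ : ℝ → E}

theorem hasDerivWithinAt_Ici_of_mem_Ico {v : ℝ → E → E} {a b t : ℝ}
    (hφ : IsIntegralCurveOn φ v (Icc a b)) (ht : t ∈ Ico a b) :
    HasDerivWithinAt φ (v t (φ t)) (Ici t) t :=
  (hφ t (Ico_subset_Icc_self ht)).mono_of_mem_nhdsWithin (Icc_mem_nhdsGE_of_mem ht)

theorem hasDerivWithinAt_Iic_of_mem_Ioc {v : ℝ → E → E} {a b t : ℝ}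
    (hφ : IsIntegralCurveOn φ v (Icc a b)) (ht : t ∈ Ioc a b) :
    HasDerivWithinAt φ (v t (φ t)) (Iic t) t :=
  (hφ t (Ioc_subset_Icc_self ht)).mono_of_mem_nhdsWithin (Icc_mem_nhdsLE_of_mem ht)

variable {f : E → E}

theorem eqOn_Icc_of_eq_left {a b : ℝ} (hf : LocallyLipschitz f)
    (hφ : IsIntegralCurveOn φ (fun _ => f) (Icc a b))
    (hψ : IsIntegralCurveOn ψ (fun _ => f) (Icc a b)) (h : φ a = ψ a) :
    EqOn φ ψ (Icc a b) := by
  obtain ⟨K, hK⟩ :=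
    exists_lipschitzOnWith_image_union hf isCompact_Icc hφ.continuousOn hψ.continuousOn
  exact ODE_solution_unique_of_mem_Icc_right (fun _ _ => hK)
    hφ.continuousOn (fun _ => hasDerivWithinAt_Ici_of_mem_Ico hφ)
    (fun _ ht => Or.inl (mem_image_of_mem φ (Ico_subset_Icc_self ht)))
    hψ.continuousOn (fun _ => hasDerivWithinAt_Ici_of_mem_Ico hψ)
    (fun _ ht => Or.inr (mem_image_of_mem ψ (Ico_subset_Icc_self ht))) h

theorem eqOn_Icc_of_eq_right {a b : ℝ} (hf : LocallyLipschitz f)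
    (hφ : IsIntegralCurveOn φ (fun _ => f) (Icc a b))
    (hψ : IsIntegralCurveOn ψ (fun _ => f) (Icc a b)) (h : φ b = ψ b) :
    EqOn φ ψ (Icc a b) := by
  obtain ⟨K, hK⟩ :=
    exists_lipschitzOnWith_image_union hf isCompact_Icc hφ.continuousOn hψ.continuousOn
  exact ODE_solution_unique_of_mem_Icc_left (fun _ _ => hK)
    hφ.continuousOn (fun _ => hasDerivWithinAt_Iic_of_mem_Ioc hφ)
    (fun _ ht => Or.inl (mem_image_of_mem φ (Ioc_subset_Icc_self ht)))
    hψ.continuousOn (fun _ => hasDerivWithinAt_Iic_of_mem_Ioc hψ)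
    (fun _ ht => Or.inr (mem_image_of_mem ψ (Ioc_subset_Icc_self ht))) h

theorem eqOn_of_ordConnected {s : Set ℝ} [s.OrdConnected] {t₀ : ℝ} (hf : LocallyLipschitz f)
    (hφ : IsIntegralCurveOn φ (fun _ => f) s) (hψ : IsIntegralCurveOn ψ (fun _ => f) s)
    (ht₀ : t₀ ∈ s) (h : φ t₀ = ψ t₀) : EqOn φ ψ s := by
  intro t ht
  rcases le_total t₀ t with hle | hle
  · have hsub : Icc t₀ t ⊆ s := s.Icc_subset ht₀ ht
    exact eqOn_Icc_of_eq_left hf (hφ.mono hsub) (hψ.mono hsub) h (right_mem_Icc.2 hle)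
  · have hsub : Icc t t₀ ⊆ s := s.Icc_subset ht ht₀
    exact eqOn_Icc_of_eq_right hf (hφ.mono hsub) (hψ.mono hsub) h (left_mem_Icc.2 hle)

theorem contDiff_one_of_isIntegralCurve (hf : Continuous f)
    (hφ : IsIntegralCurve φ (fun _ => f)) : ContDiff ℝ 1 φ := by
  have hderiv : deriv φ = f ∘ φ := funext fun t => (hφ t).deriv
  exact contDiff_one_iff_deriv.2
    ⟨fun t => (hφ t).differentiableAt, hderiv ▸ hf.comp hφ.continuous⟩

theorem dimH_range_le_one_of_isIntegralCurve (hf : Continuous f)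
    (hφ : IsIntegralCurve φ (fun _ => f)) : dimH (range φ) ≤ 1 := by
  simpa using (contDiff_one_of_isIntegralCurve hf hφ).dimH_range_le

end IntegralCurve

variable {n : ℕ} {f : Space n → Space n} {ξ ξ' η η' x : Space n} {κ X : Set (Space n)}

theorem eq_of_mem_stableManifold (hf : LocallyLipschitz f) (h : x ∈ stableManifold f η)
    (h' : x ∈ stableManifold f η') : η = η' := by
  obtain ⟨φ, hφ, hφ₀, hφ_lim⟩ := h
  obtain ⟨ψ, hψ, hψ₀, hψ_lim⟩ := h'
  have heq : EqOn φ ψ (Ici 0) :=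
    eqOn_of_ordConnected hf hφ hψ self_mem_Ici (hφ₀.trans hψ₀.symm)
  exact tendsto_nhds_unique (hφ_lim.congr' (heq.eventuallyEq_of_mem (Ici_mem_atTop 0))) hψ_lim

theorem eq_of_mem_unstableManifold (hf : LocallyLipschitz f) (h : x ∈ unstableManifold f ξ)
    (h' : x ∈ unstableManifold f ξ') : ξ = ξ' := by
  obtain ⟨φ, hφ, hφ₀, hφ_lim⟩ := h
  obtain ⟨ψ, hψ, hψ₀, hψ_lim⟩ := h'
  have heq : EqOn φ ψ (Iic 0) :=
    eqOn_of_ordConnected hf hφ hψ self_mem_Iic (hφ₀.trans hψ₀.symm)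
  exact tendsto_nhds_unique (hφ_lim.congr' (heq.eventuallyEq_of_mem (Iic_mem_atBot 0))) hψ_lim

theorem exists_isIntegralCurveOn_of_mem_unstableManifold (hx : x ∈ unstableManifold f ξ)
    {U : Set (Space n)} (hU : U ∈ 𝓝 ξ) :
    ∃ t > 0, ∃ χ : ℝ → Space n,
      IsIntegralCurveOn χ (fun _ => f) (Icc 0 t) ∧ χ 0 ∈ U ∧ χ t = x := by
  obtain ⟨φ, hφ, rfl, hφ_lim⟩ := hx
  obtain ⟨s, hsU, hs⟩ := ((hφ_lim.eventually_mem hU).and (eventually_lt_atBot 0)).exists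
  refine ⟨-s, neg_pos.2 hs, φ ∘ (· + s), (hφ.comp_add s).mono fun t ht => ?_, ?_, ?_⟩
  · exact mem_vadd_set.2 ⟨t + s, by simpa using add_le_add_left ht.2 s, by simp⟩
  · simpa using hsU
  · simp

/-- Lyapunov stability of a set `X`: trajectories starting close to `X` exist for all positive times
and remain close to `X`. This is asymptotic stability without attraction. -/
def LyapunovStable (f : Space n → Space n) (X : Set (Space n)) : Prop :=
  ∀ δ > 0, ∃ ε > 0, ∀ x ∈ Metric.thickening ε X,
    ∃ φ : ℝ → Space n, IsIntegralCurveOn φ (fun _ => f) (Ici 0) ∧ φ 0 = x ∧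
      ∀ t > 0, Metric.infDist (φ t) X < δ

theorem AsymptoticallyStable.lyapunovStable (h : AsymptoticallyStable f X) :
    LyapunovStable f X := by
  intro δ hδ
  obtain ⟨ε, hε, hsub⟩ := h δ hδ
  refine ⟨ε, hε, fun x hx => ?_⟩
  obtain ⟨φ, hφ, hφ₀, hφδ, -⟩ := hsub hx
  exact ⟨φ, hφ, hφ₀, hφδ⟩

theorem LyapunovStable.unstableManifold_subset_closure (hf : LocallyLipschitz f)
    (h : LyapunovStable f X) (hξ : ξ ∈ closure X) : unstableManifold f ξ ⊆ closure X := by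
  intro x hx
  have hX : X.Nonempty := closure_nonempty_iff.1 ⟨ξ, hξ⟩
  suffices hlt : ∀ δ > 0, Metric.infDist x X < δ from
    (Metric.mem_closure_iff_infDist_zero hX).2 <|
      (le_of_forall_gt fun δ hδ => hlt δ hδ).antisymm Metric.infDist_nonneg
  intro δ hδ
  obtain ⟨ε, hε, hstable⟩ := h δ hδ
  have hnhds : Metric.thickening ε X ∈ 𝓝 ξ :=
    Metric.isOpen_thickening.mem_nhds (Metric.closure_subset_thickening hε X hξ)
  obtain ⟨t, ht, χ, hχ, hχ₀, rfl⟩ := exists_isIntegralCurveOn_of_mem_unstableManifold hx hnhds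
  obtain ⟨ψ, hψ, hψ₀, hψδ⟩ := hstable _ hχ₀
  have heq : ψ t = χ t :=
    eqOn_Icc_of_eq_left hf (hψ.mono Icc_subset_Ici_self) hχ hψ₀ (right_mem_Icc.2 ht.le)
  exact heq ▸ hψδ t ht

theorem LyapunovStable.unstableDim_le_dimH_closure (hf : LocallyLipschitz f)
    (h : LyapunovStable f X) (hξ : ξ ∈ closure X) : unstableDim f ξ ≤ dimH (closure X) :=
  dimH_mono (h.unstableManifold_subset_closure hf hξ)

/-- The ends of a connection `κ`: the points from which or to which `κ` is a connection. Sources and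
targets are not distinguished; the set is empty when `κ` is not a connection. -/
def endpoints (f : Space n → Space n) (κ : Set (Space n)) : Set (Space n) :=
  {x | (∃ η, IsConnection f x η κ) ∨ ∃ ξ, IsConnection f ξ x κ}

namespace IsConnection

theorem nonempty (h : IsConnection f ξ η κ) : κ.Nonempty := by
  obtain ⟨⟨φ, -, -, rfl⟩, -⟩ := h
  exact range_nonempty φ

theorem source_eq (hf : LocallyLipschitz f) (h : IsConnection f ξ η κ)
    (h' : IsConnection f ξ' η' κ) : ξ = ξ' := by
  obtain ⟨x, hx⟩ := h.nonempty
  exact eq_of_mem_unstableManifold hf (h.2 hx).1 (h'.2 hx).1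

theorem target_eq (hf : LocallyLipschitz f) (h : IsConnection f ξ η κ)
    (h' : IsConnection f ξ' η' κ) : η = η' := by
  obtain ⟨x, hx⟩ := h.nonempty
  exact eq_of_mem_stableManifold hf (h.2 hx).2 (h'.2 hx).2

theorem endpoints_eq (hf : LocallyLipschitz f) (h : IsConnection f ξ η κ) :
    endpoints f κ = {ξ, η} := by
  ext x
  constructor
  · rintro (⟨_, hx⟩ | ⟨_, hx⟩)
    · exact Or.inl (hx.source_eq hf h)
    · exact Or.inr (hx.target_eq hf h)
  · rintro (rfl | rfl)
    · exact Or.inl ⟨η, h⟩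
    · exact Or.inr ⟨ξ, h⟩

theorem dimH_le_one (hf : Continuous f) (h : IsConnection f ξ η κ) : dimH κ ≤ 1 := by
  obtain ⟨⟨φ, hφ, -, rfl⟩, -⟩ := h
  exact dimH_range_le_one_of_isIntegralCurve hf hφ

end IsConnection

variable {Γ : Type*} [Group Γ] [DistribMulAction Γ (Space n)]

theorem Cycle.exists_mem_endpoints (C : Cycle Γ f) (i : Fin (C.m + 1)) :
    ∃ j, C.ξ i ∈ endpoints f (C.κ j) := by
  rcases eq_or_ne i 0 with rfl | hi
  · exact ⟨⟨0, C.m_pos⟩, Or.inl ⟨_, C.isConnection _⟩⟩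
  · obtain ⟨j, rfl⟩ := Fin.exists_succ_eq.2 hi
    exact ⟨j, Or.inr ⟨_, C.isConnection j⟩⟩

namespace Network

variable (N : Network Γ f)

theorem exists_isConnection_of_mem_connections (hκ : κ ∈ N.connections) :
    ∃ ξ η, IsConnection f ξ η κ := by
  obtain ⟨C, -, j, rfl⟩ := hκ
  exact ⟨_, _, C.isConnection j⟩

theorem equilibria_subset_biUnion_endpoints :
    N.equilibria ⊆ ⋃ κ ∈ N.connections, endpoints f κ := by
  rintro _ ⟨C, hC, i, rfl⟩
  obtain ⟨j, hj⟩ := C.exists_mem_endpoints i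
  exact mem_biUnion ⟨C, hC, j, rfl⟩ hj

theorem countable_equilibria (hf : LocallyLipschitz f) (hN : N.connections.Countable) :
    N.equilibria.Countable := by
  refine (hN.biUnion fun κ hκ => ?_).mono N.equilibria_subset_biUnion_endpoints
  obtain ⟨ξ, η, h⟩ := N.exists_isConnection_of_mem_connections hκ
  exact h.endpoints_eq hf ▸ (toFinite {ξ, η}).countable

theorem equilibria_subset_carrier : N.equilibria ⊆ N.carrier := by
  rintro _ ⟨C, hC, i, rfl⟩
  exact mem_biUnion hC (Or.inl (mem_range_self i))

theorem carrier_subset_equilibria_union_sUnion_connections :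
    N.carrier ⊆ N.equilibria ∪ ⋃₀ N.connections := by
  refine iUnion₂_subset fun C hC => union_subset ?_ (iUnion_subset fun j => ?_)
  · rintro _ ⟨i, rfl⟩
    exact Or.inl ⟨C, hC, i, rfl⟩
  · have hj : C.κ j ∈ N.connections := ⟨C, hC, j, rfl⟩
    exact subset_union_of_subset_right (subset_sUnion_of_mem hj) _

theorem dimH_carrier_le_one (hf : LocallyLipschitz f) (hN : N.connections.Countable) :
    dimH N.carrier ≤ 1 := by
  have hequilibria : dimH N.equilibria ≤ 1 :=
    (N.countable_equilibria hf hN).dimH_zero.trans_le zero_le_one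
  have hconnections : dimH (⋃₀ N.connections) ≤ 1 := by
    rw [dimH_sUnion hN]
    refine iSup₂_le fun κ hκ => ?_
    obtain ⟨ξ, η, h⟩ := N.exists_isConnection_of_mem_connections hκ
    exact h.dimH_le_one hf.continuous
  calc
    dimH N.carrier ≤ dimH (N.equilibria ∪ ⋃₀ N.connections) :=
      dimH_mono N.carrier_subset_equilibria_union_sUnion_connections
    _ = max (dimH N.equilibria) (dimH (⋃₀ N.connections)) := dimH_union _ _
    _ ≤ 1 := max_le hequilibria hconnections

end Network

end Heteroclinic

theorem corollary3p2_general {n : ℕ} {Γ : Type*} [Group Γ]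
    [DistribMulAction Γ (Heteroclinic.Space n)]
    {f : Heteroclinic.Space n → Heteroclinic.Space n} (hf : LocallyLipschitz f)
    (N : Heteroclinic.Network Γ f) (hclosed : IsClosed N.carrier)
    (hcountable : N.connections.Countable)
    (hdim : ∃ ξ ∈ N.equilibria, 1 < Heteroclinic.unstableDim f ξ) :
    ¬ Heteroclinic.LyapunovStable f N.carrier := by
  intro hstable
  obtain ⟨ξ, hξ, hone_lt⟩ := hdim
  have hξ_closure : ξ ∈ closure N.carrier := subset_closure (N.equilibria_subset_carrier hξ)
  refine hone_lt.not_ge ?_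
  calc
    Heteroclinic.unstableDim f ξ ≤ dimH (closure N.carrier) :=
      hstable.unstableDim_le_dimH_closure hf hξ_closure
    _ = dimH N.carrier := by rw [hclosed.closure_eq]
    _ ≤ 1 := N.dimH_carrier_le_one hf hcountable

theorem corollary3p2 {n : ℕ} {Γ : Type*} [Group Γ] [TopologicalSpace Γ] [IsTopologicalGroup Γ]
    [CompactSpace Γ] [DistribMulAction Γ (Heteroclinic.Space n)]
    [SMulCommClass Γ ℝ (Heteroclinic.Space n)] [ContinuousSMul Γ (Heteroclinic.Space n)]
    (f : Heteroclinic.Space n → Heteroclinic.Space n) (hf : ContDiff ℝ 1 f)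
    (hequiv : ∀ (γ : Γ) (x : Heteroclinic.Space n), f (γ • x) = γ • f x)
    (N : Heteroclinic.Network Γ f) (hcompact : IsCompact N.carrier)
    (hfinite : N.connections.Finite)
    (hdim : ∃ ξ ∈ N.equilibria, 2 ≤ Heteroclinic.unstableDim f ξ) :
    ¬ Heteroclinic.AsymptoticallyStable f N.carrier := by
  obtain ⟨ξ, hξ, htwo_le⟩ := hdim
  exact fun hstable => corollary3p2_general hf.locallyLipschitz N hcompact.isClosed
    hfinite.countable ⟨ξ, hξ, ENNReal.one_lt_two.trans_le htwo_le⟩ hstable.lyapunovStable
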